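/- **Model.** There are $N$ rider types and time is discrete. In each period at most one rider arrives, of type $i$ with probability $\Lambda_i\ge 0$, $\sum_i\Lambda_i\le 1$, independently over periods. The platform fixes conversion probabilities $\boldsymbol\lambda\in[0,1]^N$ by posting prices $p_i(\lambda_i)$, so that a type-$i$ rider makes a request in a period with probability $\Lambda_i\lambda_i$. A solo trip of type $i$ takes $\ell_i\ge 1$ periods (an integer), travel costs $c$ per period, and an unmatched new rider waits up to $T\ge 0$ periods at the origin before departing; $T=0$ is the pure on-trip model and $T>0$ the combined pre-trip/on-trip model. The states of an existing solo rider are $\mathcal C=\{(i,u): i\in[N],\ -T+1\le u\le \ell_i-1\}$, where $u\le 0$ means waiting at the origin and $u\ge1$ is the number of periods since departure. For $(j,u)\in\mathcal C$, $\mathcal N^+_{j,u}\subseteq[N]$ is the set of types compatible with $(j,u)$, and $\ell_{i,j}^u$ is the length of the shared trip when a new type-$i$ rider is matched with $(j,u)$. The results hold for arbitrary price functions $p_i:[0,1]\to\mathbb R$, arbitrary compatibility sets $\mathcal N^+_{j,u}$, and arbitrary real $c$ and $\ell_{i,j}^u$. The state of the system is the set $\mathbf s\subseteq\mathcal C$ of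 occupied solo states. A stationary matching policy $\boldsymbol\phi$ decides, when a type-$i$ rider requests in state $\mathbf s$, either to match that rider with some $(j,u)\in\mathbf s$ such that $i\in\mathcal N^+_{j,u}$ (the rider $(j,u)$ then leaves the set of solo riders), or not to match (the new rider then has position $(i,-T)$). At the end of the period every remaining solo rider moves from $(i,u)$ to $(i,u+1)$; riders at $u=\ell_i-1$ reach their destination and leave. Each type-$i$ rider who reaches the destination unmatched yields the profit $p_i(\lambda_i)-c\ell_i$, and each match of a new type-$i$ rider with $(j,u)$ yields $p_i(\lambda_i)+p_j(\lambda_j)-c\max\{u,0\}-c\ell_{i,j}^u$. With $\Pi_t^{\boldsymbol\lambda,\boldsymbol\phi}$ the total profit of the first $t$ periods, let $$\Pi=\sup_{\boldsymbol\lambda,\boldsymbol\phi}\ \lim_{t\to\infty}\tfrac1t\,\mathbb E\big[\Pi_t^{\boldsymbol\lambda,\boldsymbol\phi}\big].$$ **Fluid relaxation.** Let $$g=\sup_{\boldsymbol\lambda\in[0,1]^N}\Big(\sum_i\Lambda_i\lambda_i p_i(\lambda_i)-C(\boldsymbol\lambda)\Big),$$ where $C(\boldsymbol\lambda)$ is the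 minimum of $$\sum_{i}\sum_{u=0}^{\ell_i-1}c\,y_i^u+\sum_i\sum_{(j,u)\in\mathcal C:\,i\in\mathcal N^+_{j,u}}c\,\ell_{i,j}^u\,x_{i,j}^u$$ over all $x_{i,j}^u\ge0$ ($(j,u)\in\mathcal C$, $i\in\mathcal N^+_{j,u}$) and $y_i^u\ge0$ ($i\in[N]$, $-T\le u\le\ell_i-1$) such that $$\sum_{(j,u)\in\mathcal C:\,i\in\mathcal N^+_{j,u}}x_{i,j}^u+y_i^{-T}=\Lambda_i\lambda_i\quad(i\in[N]),$$ $$\sum_{i\in\mathcal N^+_{j,u}}x_{i,j}^u+y_j^u=y_j^{u-1}\quad((j,u)\in\mathcal C),$$ $$\Lambda_i\lambda_i\,y_j^u\ \ge\ \Big(1-\sum_{k\in\mathcal N^+_{j,u}}\Lambda_k\lambda_k\Big)x_{i,j}^u\quad((j,u)\in\mathcal C,\ i\in\mathcal N^+_{j,u}).$$ **Proposition.** For every initial state $\mathbf s_0\subseteq\mathcal C$, the limit defining the long-run average profit exists for all $\boldsymbol\lambda$ and $\boldsymbol\phi$, the minimum defining $C(\boldsymbol\lambda)$ is attained for every $\boldsymbol\lambda\in[0,1]^N$,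 and $g\ge\Pi$ (both suprema taken in the extended reals). -/

import Mathlib

open MeasureTheory Filter Topology

/-- Data of the shared-ride pricing and matching model with `N` rider types.

Positions of riders are integers `u`. A rider of type `i` who has just converted has position `-T`;
`-T < u ≤ 0` means that the rider still waits at the origin with `|u|` waiting periods left, and
`1 ≤ u ≤ ℓ i - 1` means that the rider left the origin `u` periods ago and travels alone.
The pure on-trip model is the case `T = 0`. -/
structure RideModel (N : ℕ) where
  /-- probability that a rider of type `i` arrives in a given period -/
  Λ : Fin N → ℝ
  Λ_nonneg : ∀ i, 0 ≤ Λ i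
  Λ_sum_le_one : ∑ i, Λ i ≤ 1
  /-- the price `p_i(z)` which induces the conversion probability `z` -/
  price : Fin N → unitInterval → ℝ
  /-- operational cost per unit of distance -/
  c : ℝ
  /-- solo trip length `ℓ_i` -/
  ℓ : Fin N → ℕ
  ℓ_pos : ∀ i, 1 ≤ ℓ i
  /-- maximal number of waiting periods before departure -/
  T : ℕ
  /-- `sharedLen i (j, u)` is the length `ℓ_{i,j}^u` of the shared trip, from the time of the match,
  when a new rider of type `i` is matched with a solo rider in state `(j, u)` -/
  sharedLen : Fin N → Fin N × ℤ → ℝ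
  /-- `compat (j, u)` is the set `𝒩⁺_{j,u}` of the types which are compatible with a solo rider
  in state `(j, u)` -/
  compat : Fin N × ℤ → Finset (Fin N)

/-- What is observed in one period: no request (`none`), or a request by one rider of type `i`
(`some i`). -/
abbrev Request (N : ℕ) : Type := Option (Fin N)

instance instMeasurableSpaceRequest (N : ℕ) : MeasurableSpace (Request N) := ⊤

/-- A system state: the set of all `(i, u)` with a solo rider present in that state. -/
abbrev SystemState (N : ℕ) : Type := Finset (Fin N × ℤ)

namespace RideModel

variable {N : ℕ} (M : RideModel N)

/-- The set `𝒞` of the states `(i, u)`, `-T + 1 ≤ u ≤ ℓ_i - 1`, of a solo rider. -/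
noncomputable def soloStates : Finset (Fin N × ℤ) :=
  Finset.univ.biUnion fun i : Fin N =>
    (Finset.Icc (-(M.T : ℤ) + 1) ((M.ℓ i : ℤ) - 1)).image fun u => (i, u)

theorem mem_soloStates (i : Fin N) (u : ℤ) :
    (i, u) ∈ M.soloStates ↔ -(M.T : ℤ) + 1 ≤ u ∧ u ≤ (M.ℓ i : ℤ) - 1 := by
  simp [soloStates]

/-- A static pricing policy, given by the conversion probabilities `lam i ∈ [0, 1]`. -/
abbrev PricingPolicy (_ : RideModel N) : Type := Fin N → unitInterval

/-- A stationary matching policy. When a rider of type `i` converts while the system is in state `s`,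
`act i s = some (j, u)` matches the new rider with the solo rider in state `(j, u)`, which must be
present and compatible; `act i s = none` means that the new rider is not matched. -/
structure MatchingPolicy where
  act : Fin N → SystemState N → Option (Fin N × ℤ)
  admissible : ∀ i s q, act i s = some q → q ∈ s ∧ i ∈ M.compat q

/-- Rate `Λ_i λ_i` of requests of type `i`. -/
def rate (lam : M.PricingPolicy) (i : Fin N) : ℝ := M.Λ i * (lam i : ℝ)

theorem rate_nonneg (lam : M.PricingPolicy) (i : Fin N) : 0 ≤ M.rate lam i :=
  mul_nonneg (M.Λ_nonneg i) (lam i).2.1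

theorem sum_rate_le_one (lam : M.PricingPolicy) : ∑ i, M.rate lam i ≤ 1 :=
  (Finset.sum_le_sum fun i _ =>
    mul_le_of_le_one_right (M.Λ_nonneg i) (lam i).2.2).trans M.Λ_sum_le_one

/-! ### The Markov decision process -/

/-- Law of the request of one period: type `i` with probability `Λ_i λ_i`, no request otherwise. -/
noncomputable def requestLaw (lam : M.PricingPolicy) : Measure (Request N) :=
  ENNReal.ofReal (1 - ∑ i, M.rate lam i) • Measure.dirac none +
    ∑ i, ENNReal.ofReal (M.rate lam i) • Measure.dirac (some i)

instance instIsProbabilityMeasureRequestLaw (lam : M.PricingPolicy) :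
    IsProbabilityMeasure (M.requestLaw lam) := by
  constructor
  have h0 : ∀ i ∈ Finset.univ, 0 ≤ M.rate lam i := fun i _ => M.rate_nonneg lam i
  have h1 : 0 ≤ 1 - ∑ i, M.rate lam i := sub_nonneg.2 (M.sum_rate_le_one lam)
  simp only [requestLaw, Measure.add_apply, Measure.smul_apply, Measure.finsetSum_apply,
    measure_univ, smul_eq_mul, mul_one]
  rw [← ENNReal.ofReal_sum_of_nonneg h0, ← ENNReal.ofReal_add h1 (Finset.sum_nonneg h0)]
  simp

/-- Law of the sequence of requests in the periods `0, 1, 2, …`: independent, identically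
distributed. -/
noncomputable def processLaw (lam : M.PricingPolicy) : Measure (ℕ → Request N) :=
  Measure.infinitePi fun _ : ℕ => M.requestLaw lam

variable {M}

/-- The riders who continue alone after the decision of a period which starts in state `s` with
request `a`; a new rider of type `i` who is not matched appears as `(i, -T)`. -/
def remaining (φ : M.MatchingPolicy) (s : SystemState N) (a : Request N) : SystemState N :=
  match a with
  | none => s
  | some i =>
    match φ.act i s with
    | none => insert (i, -(M.T : ℤ)) s
    | some q => s.erase q

/-- The next state: all remaining riders move forward by one, and those who reach their destination
leave the system. -/
noncomputable def step (φ : M.MatchingPolicy) (s : SystemState N) (a : Request N) : SystemState N :=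
  ((remaining φ s a).image fun q => (q.1, q.2 + 1)).filter fun q => q ∈ M.soloStates

/-- State at time `t` when the system starts in `s₀` and the requests are `ω`. -/
noncomputable def stateAt (φ : M.MatchingPolicy) (s₀ : SystemState N) (ω : ℕ → Request N) : ℕ → SystemState N
  | 0 => s₀
  | t + 1 => step φ (stateAt φ s₀ ω t) (ω t)

/-- Number of riders of type `i` who, in the first `t` periods, complete their trip without having
been matched. -/
noncomputable def soloCount (φ : M.MatchingPolicy) (s₀ : SystemState N) (ω : ℕ → Request N) (t : ℕ)
    (i : Fin N) : ℕ :=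
  ((Finset.range t).filter fun τ =>
    (i, (M.ℓ i : ℤ) - 1) ∈ remaining φ (stateAt φ s₀ ω τ) (ω τ)).card

/-- Number of matches, in the first `t` periods, between a new rider of type `i` and a solo rider in
state `q = (j, u)`. -/
noncomputable def matchCount (φ : M.MatchingPolicy) (s₀ : SystemState N) (ω : ℕ → Request N) (t : ℕ)
    (i : Fin N) (q : Fin N × ℤ) : ℕ :=
  ((Finset.range t).filter fun τ =>
    ω τ = some i ∧ φ.act i (stateAt φ s₀ ω τ) = some q).card

/-- Total profit in the first `t` periods: `p_i - c ℓ_i` for each rider who ends up solo, and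
`p_i + p_j - c max(u, 0) - c ℓ_{i,j}^u` for each match of a new rider of type `i` with a solo rider
in state `(j, u)`; the latter has travelled the distance `max(u, 0)` before. -/
noncomputable def totalProfit (lam : M.PricingPolicy) (φ : M.MatchingPolicy) (s₀ : SystemState N)
    (t : ℕ) (ω : ℕ → Request N) : ℝ :=
  ∑ i, (soloCount φ s₀ ω t i : ℝ) * (M.price i (lam i) - M.c * M.ℓ i) +
    ∑ i, ∑ q ∈ M.soloStates, (matchCount φ s₀ ω t i q : ℝ) *
      (M.price i (lam i) + M.price q.1 (lam q.1)
        - M.c * ((max q.2 0 : ℤ) : ℝ) - M.c * M.sharedLen i q)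

/-- Expected profit per period over the first `t` periods. -/
noncomputable def averageProfit (lam : M.PricingPolicy) (φ : M.MatchingPolicy)
    (s₀ : SystemState N) (t : ℕ) : ℝ :=
  (1 / (t : ℝ)) * ∫ ω, totalProfit lam φ s₀ t ω ∂(M.processLaw lam)

/-- Long-run average profit of a pair of stationary policies. -/
noncomputable def longRunProfit (lam : M.PricingPolicy) (φ : M.MatchingPolicy)
    (s₀ : SystemState N) : ℝ :=
  limUnder atTop (averageProfit lam φ s₀)

variable (M)

/-- The optimal long-run average profit over all static pricing policies and all stationary matching
policies. It is an extended real number, as the prices need not be bounded. -/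
noncomputable def optimalProfit (s₀ : SystemState N) : EReal :=
  ⨆ (lam : M.PricingPolicy) (φ : M.MatchingPolicy), ((longRunProfit lam φ s₀ : ℝ) : EReal)

/-! ### The fluid relaxation -/

/-- Feasible flows of the inner linear program: `x i (j, u)` stands for `x_{i,j}^u` and `y i u` for
`y_i^u`. Values of `x` and `y` outside the index sets of the program play no role. -/
structure IsFluidFeasible (lam : M.PricingPolicy) (x : Fin N → Fin N × ℤ → ℝ)
    (y : Fin N → ℤ → ℝ) : Prop where
  demand : ∀ i, ∑ q ∈ M.soloStates with i ∈ M.compat q, x i q + y i (-(M.T : ℤ)) = M.rate lam i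
  balance : ∀ j u, (j, u) ∈ M.soloStates →
    ∑ i ∈ M.compat (j, u), x i (j, u) + y j u = y j (u - 1)
  ratio : ∀ j u, (j, u) ∈ M.soloStates → ∀ i ∈ M.compat (j, u),
    (1 - ∑ k ∈ M.compat (j, u), M.rate lam k) * x i (j, u) ≤ M.rate lam i * y j u
  x_nonneg : ∀ j u, (j, u) ∈ M.soloStates → ∀ i ∈ M.compat (j, u), 0 ≤ x i (j, u)
  y_nonneg : ∀ i u, -(M.T : ℤ) ≤ u → u ≤ (M.ℓ i : ℤ) - 1 → 0 ≤ y i u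

/-- Objective of the inner linear program. -/
noncomputable def flowCost (x : Fin N → Fin N × ℤ → ℝ) (y : Fin N → ℤ → ℝ) : ℝ :=
  ∑ i, ∑ u ∈ Finset.Icc (0 : ℤ) ((M.ℓ i : ℤ) - 1), M.c * y i u +
    ∑ i, ∑ q ∈ M.soloStates with i ∈ M.compat q, M.c * M.sharedLen i q * x i q

/-- The objective values of the feasible flows of the inner linear program. -/
def feasibleCosts (lam : M.PricingPolicy) : Set ℝ :=
  {v | ∃ x y, M.IsFluidFeasible lam x y ∧ M.flowCost x y = v}

/-- Optimal value `C(λ)` of the inner linear program. -/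
noncomputable def fluidCost (lam : M.PricingPolicy) : ℝ := sInf (M.feasibleCosts lam)

/-- Optimal value `g` of the fluid relaxation. -/
noncomputable def fluidValue : EReal :=
  ⨆ lam : M.PricingPolicy,
    ((∑ i, M.rate lam i * M.price i (lam i) - M.fluidCost lam : ℝ) : EReal)

end RideModel

/-! Fix `lam` and `φ`. Requests are i.i.d. and there are finitely many states, so the states form a
finite Markov chain whose transition operator does not increase the sup norm. The mean ergodic
theorem in finite dimension yields limits of time averages from every initial state, without
irreducibility. They define a linear, monotone, normalised functional `J` that is invariant under
one step (`exists_longRunMean`).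

The frequencies under `J` of matches and of riders continuing alone form a feasible flow
(`isFluidFeasible_of_stationary`). Demand and balance express conservation of riders. The ratio
constraint already holds state by state (`ratio_requestMean`). Summation by parts identifies the
long-run profit with revenue minus the cost of this flow (`IsFluidFeasible.profit_eq`), hence it is
at most revenue minus `fluidCost lam`. The inner minimum is attained by compactness, since the
coordinates that matter lie in `[0, 1]`. -/

/-! ### Mean ergodic theorem in finite dimension. -/

theorem LinearMap.exists_tendsto_birkhoffAverage {E : Type*} [NormedAddCommGroup E]
    [NormedSpace ℝ E] [FiniteDimensional ℝ E] (f : E →ₗ[ℝ] E) (hf : LipschitzWith 1 f) :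
    ∃ g : E →ₗ[ℝ] E, (∀ x, Tendsto (birkhoffAverage ℝ f _root_.id · x) atTop (𝓝 (g x))) ∧
      ∀ x, g (f x) = g x := by
  -- If `x` is fixed and `x = f z - z`, then `f^[n] z = z + n • x`. These iterates stay bounded by
  -- `‖z‖`, so `x = 0`.
  have hdisj : Disjoint (LinearMap.eqLocus f 1) (LinearMap.range (f - 1)) := by
    rw [Submodule.disjoint_def]
    rintro x hx ⟨z, hz⟩
    have hx' : f x = x := hx
    have hz' : f z = z + x := by rw [← hz]; simp
    have hn : ∀ n : ℕ, f^[n] z = z + n • x := by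
      intro n
      induction n with
      | zero => simp
      | succ n ih => rw [Function.iterate_succ_apply', ih, map_add, map_nsmul, hx', hz', succ_nsmul]; abel
    have hb : ∀ n : ℕ, n * ‖x‖ ≤ 2 * ‖z‖ := by
      intro n
      have h0 : f^[n] 0 = 0 := iterate_map_zero (f : E →+ E) n
      have h1 : ‖f^[n] z‖ ≤ ‖z‖ := by simpa [h0] using (hf.iterate n).dist_le_mul z 0
      have h2 : (n • x : E) = f^[n] z - z := by rw [hn]; abel
      calc (n : ℝ) * ‖x‖ = ‖n • x‖ := by rw [← Nat.cast_smul_eq_nsmul ℝ, norm_smul]; simp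
        _ ≤ ‖f^[n] z‖ + ‖z‖ := by rw [h2]; exact norm_sub_le _ _
        _ ≤ 2 * ‖z‖ := by linarith
    by_contra hne
    have hpos : 0 < ‖x‖ := norm_pos_iff.2 hne
    obtain ⟨n, hn⟩ := exists_nat_gt (2 * ‖z‖ / ‖x‖)
    rw [div_lt_iff₀ hpos] at hn
    exact absurd (hb n) (not_le.2 hn)
  have hcompl : IsCompl (LinearMap.eqLocus f 1) (LinearMap.range (f - 1)) := by
    refine (Submodule.isCompl_iff_disjoint _ _ ?_).2 hdisj
    rw [LinearMap.eqLocus_eq_ker_sub, add_comm, LinearMap.finrank_range_add_finrank_ker]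
  let p := Submodule.projectionOnto _ _ hcompl
  -- The limit is the projection onto the fixed vectors along the range of `f - 1`; it kills `f x -
  -- x`, whence its invariance.
  refine ⟨(LinearMap.eqLocus f 1).subtype ∘ₗ p, fun x => ?_, fun x => ?_⟩
  · refine LinearMap.tendsto_birkhoffAverage_of_ker_subset_closure f hf
      (LinearMap.toContinuousLinearMap p) (fun x => ?_) ?_ x
    · exact Submodule.projectionOnto_apply_left hcompl x
    · intro y hy
      refine subset_closure ?_
      exact (Submodule.projectionOnto_apply_eq_zero_iff hcompl).1 hy
  · have : p (f x - x) = 0 :=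
      (Submodule.projectionOnto_apply_eq_zero_iff hcompl).2 ⟨x, by simp⟩
    rw [map_sub, sub_eq_zero] at this
    simp [this]

/-! ### The Markov chain of system states and its long-run averages. -/

namespace RideModel

variable {N : ℕ} {M : RideModel N}

instance instDiscreteMeasurableSpaceRequest : DiscreteMeasurableSpace (Request N) :=
  ⟨fun _ => trivial⟩

/-- Mean of a function of the request of one period. -/
noncomputable def requestMean (lam : M.PricingPolicy) : (Request N → ℝ) →ₗ[ℝ] ℝ where
  toFun f := (1 - ∑ i, M.rate lam i) * f none + ∑ i, M.rate lam i * f (some i)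
  map_add' f g := by simp only [Pi.add_apply, mul_add, Finset.sum_add_distrib]; ring
  map_smul' r f := by
    simp only [Pi.smul_apply, smul_eq_mul, RingHom.id_apply, mul_add, Finset.mul_sum]
    congr 1
    · ring
    · exact Finset.sum_congr rfl fun i _ => by ring

theorem requestMean_apply (lam : M.PricingPolicy) (f : Request N → ℝ) :
    requestMean lam f = (1 - ∑ i, M.rate lam i) * f none + ∑ i, M.rate lam i * f (some i) := rfl

theorem requestMean_mono (lam : M.PricingPolicy) {f g : Request N → ℝ} (h : ∀ a, f a ≤ g a) :
    requestMean lam f ≤ requestMean lam g := by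
  refine add_le_add (mul_le_mul_of_nonneg_left (h _) (sub_nonneg.2 (M.sum_rate_le_one lam)))
    (Finset.sum_le_sum fun i _ => mul_le_mul_of_nonneg_left (h _) (M.rate_nonneg lam i))

theorem requestMean_const (lam : M.PricingPolicy) (r : ℝ) :
    requestMean lam (fun _ => r) = r := by
  rw [requestMean_apply, ← Finset.sum_mul]; ring

theorem requestMean_ite_eq_some (lam : M.PricingPolicy) (i : Fin N) (r : ℝ) :
    requestMean lam (fun a => if a = some i then r else 0) = M.rate lam i * r := by
  simp [requestMean_apply]

theorem integral_requestLaw (lam : M.PricingPolicy) (f : Request N → ℝ) :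
    ∫ a, f a ∂M.requestLaw lam = requestMean lam f := by
  have h1 : 0 ≤ 1 - ∑ i, M.rate lam i := sub_nonneg.2 (M.sum_rate_le_one lam)
  have hfin : ∀ i, IsFiniteMeasure
      (ENNReal.ofReal (M.rate lam i) • Measure.dirac (some i) : Measure (Request N)) :=
    fun i => Measure.smul_finite _ ENNReal.ofReal_ne_top
  have hfin0 : IsFiniteMeasure
      (ENNReal.ofReal (1 - ∑ i, M.rate lam i) • Measure.dirac none : Measure (Request N)) :=
    Measure.smul_finite _ ENNReal.ofReal_ne_top
  rw [requestLaw, integral_add_measure .of_finite .of_finite,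
    integral_finsetSum_measure fun i _ => .of_finite, requestMean_apply]
  simp [integral_smul_measure, ENNReal.toReal_ofReal, h1, M.rate_nonneg lam]

theorem stateAt_congr (φ : M.MatchingPolicy) (s₀ : SystemState N) {t : ℕ} {ω ω' : ℕ → Request N}
    (h : ∀ τ < t, ω τ = ω' τ) : stateAt φ s₀ ω t = stateAt φ s₀ ω' t := by
  induction t with
  | zero => rfl
  | succ t ih =>
    rw [stateAt, stateAt, ih fun τ hτ => h τ (by omega), h t (by omega)]

/-- The history `r` of the first `t` requests, continued without requests. -/
def extendHistory {t : ℕ} (r : Finset.range t → Request N) (τ : ℕ) : Request N :=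
  if h : τ ∈ Finset.range t then r ⟨τ, h⟩ else none

theorem stateAt_extendHistory (φ : M.MatchingPolicy) (s₀ : SystemState N) (t : ℕ)
    (ω : ℕ → Request N) :
    stateAt φ s₀ (extendHistory fun τ : Finset.range t => ω τ) t = stateAt φ s₀ ω t :=
  stateAt_congr φ s₀ fun τ hτ => by simp [extendHistory, hτ]

/-- The integrand factors through the requests of periods `0, …, t`, which take finitely many
values. -/
theorem integrable_stateAt (lam : M.PricingPolicy) (φ : M.MatchingPolicy) (s₀ : SystemState N)
    (t : ℕ) (h : SystemState N → Request N → ℝ) :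
    Integrable (fun ω => h (stateAt φ s₀ ω t) (ω t)) (M.processLaw lam) := by
  have : IsProbabilityMeasure (M.processLaw lam) := by unfold processLaw; infer_instance
  let F : (Finset.range t → Request N) × Request N → ℝ :=
    fun z => h (stateAt φ s₀ (extendHistory z.1) t) z.2
  have hm : Measurable fun ω : ℕ → Request N => ((fun τ : Finset.range t => ω τ), ω t) := by
    fun_prop
  have : Integrable F ((M.processLaw lam).map
      fun ω : ℕ → Request N => ((fun τ : Finset.range t => ω τ), ω t)) := .of_finite
  refine (this.comp_measurable hm).congr (.of_forall fun ω => ?_)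
  simp [F, stateAt_extendHistory]

/-- The state at time `t` is a function of the requests before `t`, which are independent of request
`t`; the latter can be integrated out first. -/
theorem integral_stateAt (lam : M.PricingPolicy) (φ : M.MatchingPolicy) (s₀ : SystemState N)
    (t : ℕ) (h : SystemState N → Request N → ℝ) :
    ∫ ω, h (stateAt φ s₀ ω t) (ω t) ∂M.processLaw lam =
      ∫ ω, requestMean lam (h (stateAt φ s₀ ω t)) ∂M.processLaw lam := by
  have : IsProbabilityMeasure (M.processLaw lam) := by unfold processLaw; infer_instance
  let R : (ℕ → Request N) → (Finset.range t → Request N) := fun ω τ => ω τ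
  let F : (Finset.range t → Request N) × Request N → ℝ :=
    fun z => h (stateAt φ s₀ (extendHistory z.1) t) z.2
  have hR : Measurable R := by fun_prop
  have ht : Measurable fun ω : ℕ → Request N => ω t := by fun_prop
  have hind : ProbabilityTheory.IndepFun R (fun ω => ω t) (M.processLaw lam) := by
    have h1 := (ProbabilityTheory.iIndepFun_infinitePi (P := fun _ : ℕ => M.requestLaw lam)
      (X := fun _ a => a) (fun _ => measurable_id)).indepFun_finset (Finset.range t) {t}
      (by simp) (fun i => by fun_prop)
    exact h1.comp (φ := id) (ψ := fun r : ({t} : Finset ℕ) → Request N => r ⟨t, by simp⟩)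
      measurable_id (by fun_prop)
  have hmap := (ProbabilityTheory.indepFun_iff_map_prod_eq_prod_map_map hR.aemeasurable
    ht.aemeasurable).1 hind
  have hlaw : (M.processLaw lam).map (fun ω : ℕ → Request N => ω t) = M.requestLaw lam :=
    Measure.infinitePi_map_eval (fun _ : ℕ => M.requestLaw lam) t
  have : IsProbabilityMeasure ((M.processLaw lam).map R) :=
    Measure.isProbabilityMeasure_map hR.aemeasurable
  calc ∫ ω, h (stateAt φ s₀ ω t) (ω t) ∂M.processLaw lam
      = ∫ ω, F (R ω, ω t) ∂M.processLaw lam := by simp [F, R, stateAt_extendHistory]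
    _ = ∫ z, F z ∂(M.processLaw lam).map fun ω => (R ω, ω t) := by
      rw [integral_map (hR.prodMk ht).aemeasurable (Measurable.of_discrete).aestronglyMeasurable]
    _ = ∫ r, requestMean lam (fun a => F (r, a)) ∂(M.processLaw lam).map R := by
      rw [hmap, hlaw, integral_prod _ .of_finite]
      simp only [integral_requestLaw]
    _ = ∫ ω, requestMean lam (h (stateAt φ s₀ ω t)) ∂M.processLaw lam := by
      rw [integral_map hR.aemeasurable (Measurable.of_discrete).aestronglyMeasurable]
      simp [F, R, stateAt_extendHistory]

theorem step_subset (φ : M.MatchingPolicy) (s : SystemState N) (a : Request N) :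
    step φ s a ⊆ M.soloStates := fun _ hq => (Finset.mem_filter.1 hq).2

/-- Transition operator of the Markov chain, on functions of the states of the system. -/
noncomputable def transition (lam : M.PricingPolicy) (φ : M.MatchingPolicy) :
    (M.soloStates.powerset → ℝ) →ₗ[ℝ] (M.soloStates.powerset → ℝ) where
  toFun f s := requestMean lam fun a =>
    f ⟨step φ s a, Finset.mem_powerset.2 (step_subset φ _ a)⟩
  map_add' f g := by
    ext s
    exact map_add (requestMean lam) _ _
  map_smul' r f := by
    ext s
    exact map_smul (requestMean lam) r _

theorem transition_apply (lam : M.PricingPolicy) (φ : M.MatchingPolicy)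
    (f : M.soloStates.powerset → ℝ) (s : M.soloStates.powerset) :
    transition lam φ f s = requestMean lam fun a =>
      f ⟨step φ s a, Finset.mem_powerset.2 (step_subset φ _ a)⟩ := rfl

theorem lipschitzWith_transition (lam : M.PricingPolicy) (φ : M.MatchingPolicy) :
    LipschitzWith 1 (transition lam φ) := by
  refine AddMonoidHomClass.lipschitz_of_bound_nnnorm (transition lam φ) 1 fun f => ?_
  rw [one_mul, ← NNReal.coe_le_coe, coe_nnnorm, coe_nnnorm, pi_norm_le_iff_of_nonneg (norm_nonneg f)]
  intro s
  rw [transition_apply, Real.norm_eq_abs, abs_le]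
  constructor
  · rw [← requestMean_const lam (-‖f‖)]
    exact requestMean_mono lam fun a => (abs_le.1 (norm_le_pi_norm f _)).1
  · rw [← requestMean_const lam ‖f‖]
    exact requestMean_mono lam fun a => (abs_le.1 (norm_le_pi_norm f _)).2

theorem integral_stateAt_eq_iterate (lam : M.PricingPolicy) (φ : M.MatchingPolicy)
    (s₀ : M.soloStates.powerset) (t : ℕ) (f : SystemState N → ℝ) :
    ∫ ω, f (stateAt φ s₀ ω t) ∂M.processLaw lam =
      (transition lam φ)^[t] (fun s => f s) s₀ := by
  have : IsProbabilityMeasure (M.processLaw lam) := by unfold processLaw; infer_instance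
  induction t generalizing f with
  | zero => simp [stateAt]
  | succ t ih =>
    rw [Function.iterate_succ_apply]
    simp only [stateAt]
    rw [integral_stateAt lam φ s₀ t fun s a => f (step φ s a),
      ih fun s => requestMean lam fun a => f (step φ s a)]
    rfl

/-- The long-run averages of functions of the state and the request of a period. -/
theorem exists_longRunMean (lam : M.PricingPolicy) (φ : M.MatchingPolicy)
    (s₀ : SystemState N) (hs₀ : s₀ ⊆ M.soloStates) :
    ∃ J : (SystemState N → Request N → ℝ) →ₗ[ℝ] ℝ,
      (∀ h, Tendsto (fun t : ℕ => 1 / (t : ℝ) *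
        ∑ τ ∈ Finset.range t, ∫ ω, h (stateAt φ s₀ ω τ) (ω τ) ∂M.processLaw lam)
          atTop (𝓝 (J h))) ∧
      (∀ h k, (∀ s ⊆ M.soloStates, requestMean lam (h s) ≤ requestMean lam (k s)) → J h ≤ J k) ∧
      (∀ f : SystemState N → ℝ, J (fun s a => f (step φ s a)) = J fun s _ => f s) ∧
      J (fun _ _ => 1) = 1 := by
  obtain ⟨g, hg, hinv⟩ := LinearMap.exists_tendsto_birkhoffAverage (transition lam φ)
    (lipschitzWith_transition lam φ)
  let s₁ : M.soloStates.powerset := ⟨s₀, Finset.mem_powerset.2 hs₀⟩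
  -- `Q` averages out the current request, leaving a function on the finite state space to which the
  -- ergodic limit `g` applies.
  let Q : (SystemState N → Request N → ℝ) →ₗ[ℝ] (M.soloStates.powerset → ℝ) :=
    LinearMap.pi fun s => requestMean lam ∘ₗ LinearMap.proj (s : SystemState N)
  have hQ : ∀ h s, Q h s = requestMean lam (h s) := fun h s => rfl
  let J : (SystemState N → Request N → ℝ) →ₗ[ℝ] ℝ := LinearMap.proj s₁ ∘ₗ g ∘ₗ Q
  have hJ : ∀ h, Tendsto (fun t : ℕ => 1 / (t : ℝ) *
        ∑ τ ∈ Finset.range t, ∫ ω, h (stateAt φ s₀ ω τ) (ω τ) ∂M.processLaw lam)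
          atTop (𝓝 (J h)) := by
    intro h
    refine ((tendsto_pi_nhds.1 (hg (Q h))) s₁).congr fun t => ?_
    simp only [birkhoffAverage, birkhoffSum, Pi.smul_apply, Finset.sum_apply, smul_eq_mul, id,
      one_div]
    congr 1
    refine Finset.sum_congr rfl fun τ _ => ?_
    rw [integral_stateAt]
    exact (integral_stateAt_eq_iterate lam φ s₁ τ fun s => requestMean lam (h s)).symm
  have : IsProbabilityMeasure (M.processLaw lam) := by unfold processLaw; infer_instance
  refine ⟨J, hJ, fun h k hhk => ?_, fun f => ?_, ?_⟩
  · refine le_of_tendsto_of_tendsto' (hJ h) (hJ k) fun t => ?_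
    refine mul_le_mul_of_nonneg_left (Finset.sum_le_sum fun τ _ => ?_) (by positivity)
    rw [integral_stateAt, integral_stateAt lam φ s₀ τ k]
    refine integral_mono (integrable_stateAt lam φ s₀ τ fun s _ => requestMean lam (h s))
      (integrable_stateAt lam φ s₀ τ fun s _ => requestMean lam (k s)) fun ω => hhk _ ?_
    -- The comparison is assumed only for states inside `M.soloStates`, which contains every visited
    -- state.
    cases τ with
    | zero => exact hs₀
    | succ τ => exact step_subset φ _ _
  · have h1 : Q (fun s a => f (step φ s a)) = transition lam φ fun s => f s := rfl
    have h2 : Q (fun s _ => f s) = fun s : M.soloStates.powerset => f s := by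
      ext s
      exact requestMean_const lam _
    change g (Q _) s₁ = g (Q _) s₁
    rw [h1, h2, hinv]
  · refine tendsto_nhds_unique (hJ _) (tendsto_const_nhds.congr' ?_)
    -- At `t = 0` the average is `0`, since `1 / 0 = 0`.
    filter_upwards [eventually_ne_atTop 0] with t ht
    have : (t : ℝ) ≠ 0 := Nat.cast_ne_zero.2 ht
    simp [this]

end RideModel
-- Profit of a feasible flow.
namespace RideModel

variable {N : ℕ} {M : RideModel N}

theorem sum_Icc_sub_eq (y : ℤ → ℝ) (a : ℤ) (n : ℕ) :
    ∑ u ∈ Finset.Icc (a + 1) (a + n), (y (u - 1) - y u) = y a - y (a + n) := by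
  induction n with
  | zero => simp
  | succ n ih =>
    have : Finset.Icc (a + 1) (a + (n + 1 : ℕ)) =
        insert (a + n + 1) (Finset.Icc (a + 1) (a + n)) := by
      ext u; simp only [Finset.mem_Icc, Finset.mem_insert]; push_cast; omega
    rw [this, Finset.sum_insert (by simp only [Finset.mem_Icc]; omega), ih]
    push_cast
    rw [add_sub_cancel_right, ← add_assoc]
    ring

/-- Summation by parts: with `y (u - 1) - y u` the rate of leaving at `u`, distance charged on
leaving becomes distance charged period by period. Waiting positions carry weight zero. -/
theorem sum_Icc_sub_mul_max_eq (y : ℤ → ℝ) (a : ℤ) (ha : a ≤ 0) (n : ℕ) :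
    ∑ u ∈ Finset.Icc (a + 1) n, (y (u - 1) - y u) * ((max u 0 : ℤ) : ℝ) =
      ∑ u ∈ Finset.Icc (0 : ℤ) n, y u - (n + 1) * y n := by
  induction n with
  | zero =>
    rw [Finset.sum_eq_zero]
    · simp
    · intro u hu
      simp only [Finset.mem_Icc] at hu
      rw [max_eq_right (by simpa using hu.2)]
      simp
  | succ n ih =>
    have h1 : ∀ b : ℤ, b ≤ 1 → Finset.Icc b (n + 1 : ℕ) =
        insert ((n : ℤ) + 1) (Finset.Icc b (n : ℤ)) := by
      intro b hb
      ext u; simp only [Finset.mem_Icc, Finset.mem_insert]; push_cast; omega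
    rw [h1 _ (by omega), h1 0 (by omega), Finset.sum_insert (by simp), Finset.sum_insert (by simp),
      ih, max_eq_left (by omega), add_sub_cancel_right]
    push_cast
    ring

theorem sum_soloStates (f : Fin N × ℤ → ℝ) :
    ∑ q ∈ M.soloStates, f q =
      ∑ i, ∑ u ∈ Finset.Icc (-(M.T : ℤ) + 1) ((M.ℓ i : ℤ) - 1), f (i, u) := by
  rw [soloStates, Finset.sum_biUnion]
  · refine Finset.sum_congr rfl fun i _ => Finset.sum_image ?_
    intro u _ v _ h
    exact (Prod.ext_iff.1 h).2
  · intro i _ j _ hij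
    rw [Function.onFun, Finset.disjoint_left]
    rintro q hq hq'
    simp only [Finset.mem_image] at hq hq'
    obtain ⟨u, _, rfl⟩ := hq
    obtain ⟨v, _, h⟩ := hq'
    exact hij (Prod.ext_iff.1 h).1.symm

/-- Profit rate of a feasible flow, when the profit is collected at the end of the solo trips and at
the matches. -/
theorem IsFluidFeasible.profit_eq {lam : M.PricingPolicy} {x : Fin N → Fin N × ℤ → ℝ}
    {y : Fin N → ℤ → ℝ} (h : M.IsFluidFeasible lam x y) (p : Fin N → ℝ) :
    ∑ i, y i ((M.ℓ i : ℤ) - 1) * (p i - M.c * M.ℓ i) +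
      ∑ i, ∑ q ∈ M.soloStates with i ∈ M.compat q, x i q *
        (p i + p q.1 - M.c * ((max q.2 0 : ℤ) : ℝ) - M.c * M.sharedLen i q) =
      ∑ i, M.rate lam i * p i - M.flowCost x y := by
  -- A weight depending only on the matched solo state sees only the total outflow from that state,
  -- which balance expresses through `y`.
  have hswap : ∀ F : Fin N × ℤ → ℝ,
      ∑ i, ∑ q ∈ M.soloStates with i ∈ M.compat q, x i q * F q =
        ∑ j, ∑ u ∈ Finset.Icc (-(M.T : ℤ) + 1) ((M.ℓ j : ℤ) - 1),
          (y j (u - 1) - y j u) * F (j, u) := by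
    intro F
    have h1 : ∑ i, ∑ q ∈ M.soloStates with i ∈ M.compat q, x i q * F q =
        ∑ q ∈ M.soloStates, ∑ i ∈ M.compat q, x i q * F q :=
      Finset.sum_comm' fun i q => by simp [and_comm]
    rw [h1, sum_soloStates]
    refine Finset.sum_congr rfl fun j _ => Finset.sum_congr rfl fun u hu => ?_
    rw [← Finset.sum_mul, ← h.balance j u ((M.mem_soloStates j u).2 (Finset.mem_Icc.1 hu)),
      add_sub_cancel_right]
  have htel : ∀ j, ∑ u ∈ Finset.Icc (-(M.T : ℤ) + 1) ((M.ℓ j : ℤ) - 1),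
      (y j (u - 1) - y j u) = y j (-(M.T : ℤ)) - y j ((M.ℓ j : ℤ) - 1) := by
    intro j
    have hl := M.ℓ_pos j
    have h1 : (M.ℓ j : ℤ) - 1 = -(M.T : ℤ) + (M.T + M.ℓ j - 1 : ℕ) := by omega
    rw [h1, sum_Icc_sub_eq]
  have htelmax : ∀ j, ∑ u ∈ Finset.Icc (-(M.T : ℤ) + 1) ((M.ℓ j : ℤ) - 1),
      (y j (u - 1) - y j u) * ((max u 0 : ℤ) : ℝ) =
        ∑ u ∈ Finset.Icc (0 : ℤ) ((M.ℓ j : ℤ) - 1), y j u - M.ℓ j * y j ((M.ℓ j : ℤ) - 1) := by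
    intro j
    have hl := M.ℓ_pos j
    have h1 : (M.ℓ j : ℤ) - 1 = (M.ℓ j - 1 : ℕ) := by omega
    have h2 : ((M.ℓ j - 1 : ℕ) : ℝ) + 1 = M.ℓ j := by rw [Nat.cast_sub hl]; simp
    rw [h1, sum_Icc_sub_mul_max_eq _ _ (by omega), h2]
  have h1 : ∑ i, ∑ q ∈ M.soloStates with i ∈ M.compat q, x i q *
        (p i + p q.1 - M.c * ((max q.2 0 : ℤ) : ℝ) - M.c * M.sharedLen i q) =
      ∑ i, (∑ q ∈ M.soloStates with i ∈ M.compat q, x i q) * p i +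
      ∑ i, ∑ q ∈ M.soloStates with i ∈ M.compat q, x i q * p q.1 -
      M.c * ∑ i, ∑ q ∈ M.soloStates with i ∈ M.compat q, x i q * ((max q.2 0 : ℤ) : ℝ) -
      ∑ i, ∑ q ∈ M.soloStates with i ∈ M.compat q, M.c * M.sharedLen i q * x i q := by
    simp only [Finset.mul_sum, Finset.sum_mul, ← Finset.sum_add_distrib, ← Finset.sum_sub_distrib]
    exact Finset.sum_congr rfl fun i _ => Finset.sum_congr rfl fun q _ => by ring
  rw [h1, hswap fun q => p q.1, hswap fun q => ((max q.2 0 : ℤ) : ℝ)]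
  simp only [← Finset.sum_mul, htel, htelmax, flowCost]
  simp only [← h.demand]
  rw [Finset.mul_sum, ← sub_sub, add_sub, sub_left_inj, add_sub]
  simp only [← Finset.sum_add_distrib, ← Finset.sum_sub_distrib]
  refine Finset.sum_congr rfl fun i _ => ?_
  rw [← Finset.mul_sum]
  ring

/-! ### From a stationary policy to a feasible flow. -/

section Flow

variable (φ : M.MatchingPolicy)

/-- Indicator of a match of a new rider of type `i` with a solo rider in state `q`. -/
noncomputable def matchInd (i : Fin N) (q : Fin N × ℤ) (s : SystemState N) (a : Request N) : ℝ :=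
  if a = some i ∧ φ.act i s = some q then 1 else 0

/-- Indicator of a rider in state `q` who continues alone. -/
noncomputable def remainInd (q : Fin N × ℤ) (s : SystemState N) (a : Request N) : ℝ :=
  if q ∈ remaining φ s a then 1 else 0

theorem matchInd_nonneg (i : Fin N) (q : Fin N × ℤ) (s : SystemState N) (a : Request N) :
    0 ≤ matchInd φ i q s a := by unfold matchInd; split_ifs <;> norm_num

theorem matchInd_le (i : Fin N) (q : Fin N × ℤ) (s : SystemState N) (a : Request N) :
    matchInd φ i q s a ≤ if a = some i then 1 else 0 := by
  unfold matchInd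
  split_ifs with h1 h2 h2
  · exact le_rfl
  · exact absurd h1.1 h2
  · exact zero_le_one
  · exact le_rfl

theorem remainInd_nonneg (q : Fin N × ℤ) (s : SystemState N) (a : Request N) :
    0 ≤ remainInd φ q s a := by unfold remainInd; split_ifs <;> norm_num

theorem matchInd_eq_zero {i : Fin N} {q : Fin N × ℤ} (h : i ∉ M.compat q) :
    matchInd φ i q = 0 := by
  ext s a
  exact if_neg fun h' => h (φ.admissible i s q h'.2).2

theorem remaining_none (s : SystemState N) : remaining φ s none = s := rfl

theorem remaining_of_act_eq_none {i : Fin N} {s : SystemState N} (h : φ.act i s = none) :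
    remaining φ s (some i) = insert (i, -(M.T : ℤ)) s := by
  simp only [remaining, h]

theorem remaining_of_act_eq_some {i : Fin N} {s : SystemState N} {q : Fin N × ℤ}
    (h : φ.act i s = some q) : remaining φ s (some i) = s.erase q := by
  simp only [remaining, h]

/-- Conservation behind `balance`: a rider present is either matched once or continues. The bound on
`u` excludes the position `-T` where an unmatched newcomer is inserted. -/
theorem sum_matchInd_add_remainInd {j : Fin N} {u : ℤ} (hu : -(M.T : ℤ) + 1 ≤ u)
    (s : SystemState N) (a : Request N) :
    ∑ i ∈ M.compat (j, u), matchInd φ i (j, u) s a + remainInd φ (j, u) s a =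
      if (j, u) ∈ s then 1 else 0 := by
  unfold matchInd remainInd
  rcases a with _ | i
  · rw [remaining_none]
    simp
  · have hs : ∀ k, (some i = some k ∧ φ.act k s = some (j, u)) ↔
        (k = i ∧ φ.act i s = some (j, u)) := by
      intro k
      simp only [Option.some_inj]
      exact ⟨fun h => by rcases h with ⟨rfl, h⟩; exact ⟨rfl, h⟩,
        fun h => by rcases h with ⟨rfl, h⟩; exact ⟨rfl, h⟩⟩
    simp only [hs]
    rcases hq : φ.act i s with _ | q
    · have : (j, u) ≠ (i, -(M.T : ℤ)) := by
        intro h; have := (Prod.ext_iff.1 h).2; simp only at this; omega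
      rw [remaining_of_act_eq_none φ hq]
      simp [this]
    · obtain ⟨h1, h2⟩ := φ.admissible i s q hq
      rw [remaining_of_act_eq_some φ hq]
      by_cases hqj : q = (j, u)
      · subst hqj
        simp [h1, h2]
      · simp [hqj, Ne.symm hqj]

/-- Conservation behind `demand`: a newcomer is matched or placed at `-T`, a position that no
earlier rider occupies. -/
theorem sum_matchInd_add_remainInd_origin (i : Fin N) {s : SystemState N}
    (hs : s ⊆ M.soloStates) (a : Request N) :
    ∑ q ∈ M.soloStates with i ∈ M.compat q, matchInd φ i q s a +
      remainInd φ (i, -(M.T : ℤ)) s a = if a = some i then 1 else 0 := by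
  have hnot : (i, -(M.T : ℤ)) ∉ s := fun h => by
    have := ((M.mem_soloStates _ _).1 (hs h)).1
    omega
  unfold matchInd remainInd
  rcases a with _ | k
  · simp [remaining_none, hnot]
  · by_cases hk : k = i
    · subst hk
      rcases hq : φ.act k s with _ | q
      · rw [remaining_of_act_eq_none φ hq]
        simp
      · obtain ⟨h1, h2⟩ := φ.admissible k s q hq
        rw [remaining_of_act_eq_some φ hq]
        simp [hnot, h2, hs h1]
    · rcases hq : φ.act k s with _ | q
      · rw [remaining_of_act_eq_none φ hq]
        simp [hk, hnot, Ne.symm hk]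
      · rw [remaining_of_act_eq_some φ hq]
        simp [hk, hnot]

/-- If `φ` does not match type `i` with `(j, u)` in state `s`, the left side vanishes. If it does,
the match has probability exactly `M.rate lam i`, while the rider in `(j, u)` stays at least
whenever no compatible type requests. The coefficients do not depend on `s`, so the inequality
survives averaging over states. -/
theorem ratio_requestMean (lam : M.PricingPolicy) (i : Fin N) {j : Fin N} {u : ℤ}
    (hu : -(M.T : ℤ) + 1 ≤ u) (s : SystemState N) :
    requestMean lam (((1 - ∑ k ∈ M.compat (j, u), M.rate lam k) • matchInd φ i (j, u)) s) ≤
      requestMean lam ((M.rate lam i • remainInd φ (j, u)) s) := by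
  simp only [Pi.smul_apply]
  rw [map_smul, map_smul, smul_eq_mul, smul_eq_mul]
  set R := 1 - ∑ k ∈ M.compat (j, u), M.rate lam k
  have h1 : requestMean lam (matchInd φ i (j, u) s) =
      M.rate lam i * if φ.act i s = some (j, u) then 1 else 0 := by
    rw [← requestMean_ite_eq_some]
    congr 1
    ext a
    simp only [matchInd, ite_and]
  rw [h1]
  by_cases hq : φ.act i s = some (j, u)
  · have hmem := (φ.admissible i s _ hq).1
    rw [if_pos hq, mul_one, mul_comm]
    refine mul_le_mul_of_nonneg_left ?_ (M.rate_nonneg lam i)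
    have h2 : requestMean lam ((fun _ => 1) - ∑ k ∈ M.compat (j, u),
        fun a => if a = some k then 1 else 0) = R := by
      rw [map_sub, map_sum, requestMean_const]
      simp [requestMean_ite_eq_some, R]
    rw [← h2]
    refine requestMean_mono lam fun a => ?_
    have h3 := sum_matchInd_add_remainInd φ hu s a (j := j)
    rw [if_pos hmem] at h3
    rw [Pi.sub_apply, Finset.sum_apply, sub_le_iff_le_add]
    refine h3.ge.trans ?_
    rw [add_comm]
    refine add_le_add le_rfl (Finset.sum_le_sum fun k _ => matchInd_le φ k (j, u) s a)
  · rw [if_neg hq, mul_zero, mul_zero]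
    refine mul_nonneg (M.rate_nonneg lam i) ?_
    rw [← requestMean_const lam 0]
    exact requestMean_mono lam fun a => remainInd_nonneg φ _ s a

/-- The frequencies of the matches and of the positions of the solo riders, under a stationary
averaging functional `J`, are a feasible flow. -/
theorem isFluidFeasible_of_stationary (lam : M.PricingPolicy)
    (J : (SystemState N → Request N → ℝ) →ₗ[ℝ] ℝ)
    (hmono : ∀ h k, (∀ s ⊆ M.soloStates, requestMean lam (h s) ≤ requestMean lam (k s)) →
      J h ≤ J k)
    (hstat : ∀ f : SystemState N → ℝ, J (fun s a => f (step φ s a)) = J fun s _ => f s)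
    (hone : J (fun _ _ => 1) = 1) :
    M.IsFluidFeasible lam (fun i q => J (matchInd φ i q)) (fun j u => J (remainInd φ (j, u))) := by
  -- By monotonicity in both directions, `J` depends only on the mean over the current request, in
  -- states inside `M.soloStates`.
  have hcongr : ∀ h k, (∀ s ⊆ M.soloStates, requestMean lam (h s) = requestMean lam (k s)) →
      J h = J k := fun h k hhk =>
    (hmono h k fun s hs => (hhk s hs).le).antisymm (hmono k h fun s hs => (hhk s hs).ge)
  have hnonneg : ∀ h, (∀ s a, 0 ≤ h s a) → 0 ≤ J h := by
    intro h hh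
    rw [← map_zero J]
    exact hmono _ _ fun s _ => requestMean_mono lam fun a => hh s a
  refine ⟨fun i => ?_, fun j u hu => ?_, fun j u hu i _ => ?_, fun j u _ i _ => ?_,
    fun i u _ _ => ?_⟩
  · have h1 : J (M.rate lam i • fun _ _ => 1) = M.rate lam i := by
      rw [map_smul, hone, smul_eq_mul, mul_one]
    rw [← map_sum, ← map_add, ← h1]
    refine hcongr _ _ fun s hs => ?_
    trans requestMean lam fun a => if a = some i then 1 else 0
    · congr 1
      ext a
      rw [← sum_matchInd_add_remainInd_origin φ i hs a]
      simp
    · rw [requestMean_ite_eq_some, ← requestMean_const lam (M.rate lam i * 1)]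
      rfl
  · have hu' := (M.mem_soloStates j u).1 hu
    rw [← map_sum, ← map_add]
    have h1 : (∑ i ∈ M.compat (j, u), matchInd φ i (j, u) + remainInd φ (j, u)) =
        fun s _ => if (j, u) ∈ s then 1 else 0 := by
      ext s a
      rw [← sum_matchInd_add_remainInd φ hu'.1 s a]
      simp
    -- By stationarity, occupancy of `(j, u)` may be counted after the step, where it means that a
    -- rider at `(j, u - 1)` continued alone.
    rw [h1, ← hstat]
    congr 1
    ext s a
    have : (j, u) ∈ step φ s a ↔ (j, u - 1) ∈ remaining φ s a := by
      unfold step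
      rw [Finset.mem_filter, Finset.mem_image]
      constructor
      · rintro ⟨⟨⟨k, v⟩, hq, h⟩, _⟩
        simp only [Prod.mk.injEq] at h
        obtain ⟨rfl, rfl⟩ := h
        simpa using hq
      · exact fun h => ⟨⟨_, h, by simp⟩, hu⟩
    simp only [remainInd, this]
  · have := hmono ((1 - ∑ k ∈ M.compat (j, u), M.rate lam k) • matchInd φ i (j, u))
      (M.rate lam i • remainInd φ (j, u))
      fun s _ => ratio_requestMean φ lam i ((M.mem_soloStates j u).1 hu).1 s
    rwa [map_smul, map_smul, smul_eq_mul, smul_eq_mul] at this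
  · exact hnonneg _ fun s a => matchInd_nonneg φ _ _ s a
  · exact hnonneg _ fun s a => remainInd_nonneg φ _ s a

/-- Profit of one period, as a function of the state and the request. -/
noncomputable def periodProfit (lam : M.PricingPolicy) : SystemState N → Request N → ℝ :=
  ∑ i, (M.price i (lam i) - M.c * M.ℓ i) • remainInd φ (i, (M.ℓ i : ℤ) - 1) +
    ∑ i, ∑ q ∈ M.soloStates, (M.price i (lam i) + M.price q.1 (lam q.1)
        - M.c * ((max q.2 0 : ℤ) : ℝ) - M.c * M.sharedLen i q) • matchInd φ i q

theorem totalProfit_eq_sum (lam : M.PricingPolicy) (s₀ : SystemState N) (t : ℕ)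
    (ω : ℕ → Request N) :
    totalProfit lam φ s₀ t ω =
      ∑ τ ∈ Finset.range t, periodProfit φ lam (stateAt φ s₀ ω τ) (ω τ) := by
  simp only [periodProfit, Pi.add_apply, Finset.sum_apply, Pi.smul_apply, smul_eq_mul,
    totalProfit]
  rw [Finset.sum_add_distrib]
  congr 1
  · rw [Finset.sum_comm]
    refine Finset.sum_congr rfl fun i _ => ?_
    rw [← Finset.mul_sum, mul_comm]
    simp [remainInd, soloCount]
  · symm
    rw [Finset.sum_comm]
    refine Finset.sum_congr rfl fun i _ => ?_
    rw [Finset.sum_comm]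
    refine Finset.sum_congr rfl fun q _ => ?_
    rw [← Finset.mul_sum, mul_comm]
    simp [matchInd, matchCount]

theorem averageProfit_eq (lam : M.PricingPolicy) (s₀ : SystemState N) (t : ℕ) :
    averageProfit lam φ s₀ t = 1 / (t : ℝ) * ∑ τ ∈ Finset.range t,
      ∫ ω, periodProfit φ lam (stateAt φ s₀ ω τ) (ω τ) ∂M.processLaw lam := by
  simp only [averageProfit, totalProfit_eq_sum]
  rw [integral_finsetSum _ fun τ _ => integrable_stateAt lam φ s₀ τ _]

/-- The average profit converges to the value of a feasible flow. -/
theorem exists_feasible_tendsto_averageProfit (lam : M.PricingPolicy) (s₀ : SystemState N)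
    (hs₀ : s₀ ⊆ M.soloStates) :
    ∃ x y, M.IsFluidFeasible lam x y ∧ Tendsto (averageProfit lam φ s₀) atTop
      (𝓝 (∑ i, M.rate lam i * M.price i (lam i) - M.flowCost x y)) := by
  obtain ⟨J, hJ, hmono, hstat, hone⟩ := exists_longRunMean lam φ s₀ hs₀
  have hfeas := isFluidFeasible_of_stationary φ lam J hmono hstat hone
  refine ⟨_, _, hfeas, ?_⟩
  rw [← hfeas.profit_eq]
  have h1 := (hJ (periodProfit φ lam)).congr fun t => (averageProfit_eq φ lam s₀ t).symm
  convert h1 using 2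
  -- The profit sums over all solo states, the flow only over compatible ones; incompatible matches
  -- have frequency zero.
  simp only [periodProfit, map_add, map_sum, map_smul, smul_eq_mul, Finset.sum_filter]
  congr 1
  · exact Finset.sum_congr rfl fun i _ => mul_comm _ _
  · refine Finset.sum_congr rfl fun i _ => Finset.sum_congr rfl fun q _ => ?_
    split_ifs with h
    · exact mul_comm _ _
    · rw [matchInd_eq_zero φ h, map_zero, mul_zero]

end Flow

/-! ### The inner linear program -/

/-- Everyone travels alone; this makes the linear program nonempty. -/
theorem isFluidFeasible_unmatched (lam : M.PricingPolicy) :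
    M.IsFluidFeasible lam (fun _ _ => 0) (fun i _ => M.rate lam i) where
  demand i := by simp
  balance j u _ := by simp
  ratio j u _ i _ := by simpa using mul_nonneg (M.rate_nonneg lam i) (M.rate_nonneg lam j)
  x_nonneg _ _ _ _ _ := le_rfl
  y_nonneg i _ _ _ := M.rate_nonneg lam i

theorem rate_le_one (lam : M.PricingPolicy) (i : Fin N) : M.rate lam i ≤ 1 :=
  (Finset.single_le_sum (fun k _ => M.rate_nonneg lam k) (Finset.mem_univ i)).trans
    (M.sum_rate_le_one lam)

theorem IsFluidFeasible.x_le_one {lam : M.PricingPolicy} {x : Fin N → Fin N × ℤ → ℝ}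
    {y : Fin N → ℤ → ℝ} (h : M.IsFluidFeasible lam x y) {i : Fin N} {q : Fin N × ℤ}
    (hq : q ∈ M.soloStates) (hi : i ∈ M.compat q) : x i q ≤ 1 := by
  have hl := M.ℓ_pos i
  have h1 : x i q ≤ ∑ q ∈ M.soloStates with i ∈ M.compat q, x i q :=
    Finset.single_le_sum (f := fun q => x i q)
      (fun r hr => h.x_nonneg r.1 r.2 (Finset.mem_filter.1 hr).1 i (Finset.mem_filter.1 hr).2)
      (Finset.mem_filter.2 ⟨hq, hi⟩)
  have h2 := h.demand i
  have h3 := h.y_nonneg i (-(M.T : ℤ)) le_rfl (by omega)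
  have h4 := rate_le_one lam i
  linarith

/-- By balance, `y i` is nonincreasing along the trip, and demand bounds its initial value by the
request rate. -/
theorem IsFluidFeasible.y_le_one {lam : M.PricingPolicy} {x : Fin N → Fin N × ℤ → ℝ}
    {y : Fin N → ℤ → ℝ} (h : M.IsFluidFeasible lam x y) (i : Fin N) {u : ℤ}
    (hu : -(M.T : ℤ) ≤ u) : u ≤ (M.ℓ i : ℤ) - 1 → y i u ≤ 1 := by
  induction u, hu using Int.leInduction with
  | base =>
    intro _
    have h1 : 0 ≤ ∑ q ∈ M.soloStates with i ∈ M.compat q, x i q := Finset.sum_nonneg fun r hr =>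
      h.x_nonneg r.1 r.2 (Finset.mem_filter.1 hr).1 i (Finset.mem_filter.1 hr).2
    have h2 := h.demand i
    have h4 := rate_le_one lam i
    linarith
  | succ u hu ih =>
    intro hu'
    have hmem : (i, u + 1) ∈ M.soloStates := (M.mem_soloStates _ _).2 ⟨by omega, hu'⟩
    have h1 := h.balance i (u + 1) hmem
    have h2 : 0 ≤ ∑ k ∈ M.compat (i, u + 1), x k (i, u + 1) :=
      Finset.sum_nonneg fun k hk => h.x_nonneg i (u + 1) hmem k hk
    have h3 := ih (by omega)
    rw [add_sub_cancel_right] at h1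
    linarith

/-- Feasibility and cost only depend on the values of the flow on the index sets. -/
theorem IsFluidFeasible.congr {lam : M.PricingPolicy} {x x' : Fin N → Fin N × ℤ → ℝ}
    {y y' : Fin N → ℤ → ℝ} (h : M.IsFluidFeasible lam x y)
    (hx : ∀ i, ∀ q ∈ M.soloStates, i ∈ M.compat q → x' i q = x i q)
    (hy : ∀ i u, -(M.T : ℤ) ≤ u → u ≤ (M.ℓ i : ℤ) - 1 → y' i u = y i u) :
    M.IsFluidFeasible lam x' y' ∧ M.flowCost x' y' = M.flowCost x y := by
  refine ⟨⟨fun i => ?_, fun j u hu => ?_, fun j u hu i hi => ?_, fun j u hu i hi => ?_,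
    fun i u hu hu' => ?_⟩, ?_⟩
  · have hl := M.ℓ_pos i
    rw [← h.demand i, hy i _ le_rfl (by omega)]
    congr 1
    exact Finset.sum_congr rfl fun q hq =>
      hx i q (Finset.mem_filter.1 hq).1 (Finset.mem_filter.1 hq).2
  · have hu' := (M.mem_soloStates j u).1 hu
    rw [hy j u (by omega) hu'.2, hy j (u - 1) (by omega) (by omega), ← h.balance j u hu]
    congr 1
    exact Finset.sum_congr rfl fun i hi => hx i _ hu hi
  · have hu' := (M.mem_soloStates j u).1 hu
    rw [hy j u (by omega) hu'.2, hx i _ hu hi]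
    exact h.ratio j u hu i hi
  · rw [hx i _ hu hi]
    exact h.x_nonneg j u hu i hi
  · rw [hy i u hu hu']
    exact h.y_nonneg i u hu hu'
  · unfold flowCost
    congr 1
    · refine Finset.sum_congr rfl fun i _ => Finset.sum_congr rfl fun u hu => ?_
      have := Finset.mem_Icc.1 hu
      rw [hy i u (by omega) this.2]
    · refine Finset.sum_congr rfl fun i _ => Finset.sum_congr rfl fun q hq => ?_
      rw [hx i q (Finset.mem_filter.1 hq).1 (Finset.mem_filter.1 hq).2]

/-- Although there are infinitely many coordinates, each constraint involves finitely many and so is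
closed in the product topology. -/
theorem isClosed_isFluidFeasible (lam : M.PricingPolicy) :
    IsClosed {z : (Fin N → Fin N × ℤ → ℝ) × (Fin N → ℤ → ℝ) |
      M.IsFluidFeasible lam z.1 z.2} := by
  have : {z : (Fin N → Fin N × ℤ → ℝ) × (Fin N → ℤ → ℝ) | M.IsFluidFeasible lam z.1 z.2} =
      {z | (∀ i, ∑ q ∈ M.soloStates with i ∈ M.compat q, z.1 i q + z.2 i (-(M.T : ℤ)) =
          M.rate lam i) ∧
        (∀ j u, (j, u) ∈ M.soloStates →
          ∑ i ∈ M.compat (j, u), z.1 i (j, u) + z.2 j u = z.2 j (u - 1)) ∧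
        (∀ j u, (j, u) ∈ M.soloStates → ∀ i ∈ M.compat (j, u),
          (1 - ∑ k ∈ M.compat (j, u), M.rate lam k) * z.1 i (j, u) ≤ M.rate lam i * z.2 j u) ∧
        (∀ j u, (j, u) ∈ M.soloStates → ∀ i ∈ M.compat (j, u), 0 ≤ z.1 i (j, u)) ∧
        (∀ i u, -(M.T : ℤ) ≤ u → u ≤ (M.ℓ i : ℤ) - 1 → 0 ≤ z.2 i u)} := by
    ext z
    exact ⟨fun h => ⟨h.1, h.2, h.3, h.4, h.5⟩, fun ⟨h1, h2, h3, h4, h5⟩ => ⟨h1, h2, h3, h4, h5⟩⟩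
  rw [this]
  simp only [Set.ofPred_and, Set.ofPred_forall]
  refine IsClosed.inter ?_ (IsClosed.inter ?_ (IsClosed.inter ?_ (IsClosed.inter ?_ ?_)))
  · exact isClosed_iInter fun i => isClosed_eq (by fun_prop) (by fun_prop)
  · exact isClosed_iInter fun j => isClosed_iInter fun u => isClosed_iInter fun _ =>
      isClosed_eq (by fun_prop) (by fun_prop)
  · exact isClosed_iInter fun j => isClosed_iInter fun u => isClosed_iInter fun _ =>
      isClosed_iInter fun i => isClosed_iInter fun _ => isClosed_le (by fun_prop) (by fun_prop)
  · exact isClosed_iInter fun j => isClosed_iInter fun u => isClosed_iInter fun _ =>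
      isClosed_iInter fun i => isClosed_iInter fun _ => isClosed_le (by fun_prop) (by fun_prop)
  · exact isClosed_iInter fun i => isClosed_iInter fun u => isClosed_iInter fun _ =>
      isClosed_iInter fun _ => isClosed_le (by fun_prop) (by fun_prop)

theorem exists_isLeast_feasibleCosts (lam : M.PricingPolicy) :
    ∃ v, IsLeast (M.feasibleCosts lam) v := by
  classical
  -- Coordinates outside the index sets are unconstrained, so the feasible set itself need not be
  -- compact; its part in the unit cube is, by Tychonoff.
  let K : Set ((Fin N → Fin N × ℤ → ℝ) × (Fin N → ℤ → ℝ)) :=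
    Set.Icc 0 1 ∩ {z | M.IsFluidFeasible lam z.1 z.2}
  have hK : IsCompact K := by
    refine IsCompact.inter_right ?_ (isClosed_isFluidFeasible lam)
    have h1 : Set.Icc (0 : (Fin N → Fin N × ℤ → ℝ) × (Fin N → ℤ → ℝ)) 1 =
        (Set.univ.pi fun _ => Set.univ.pi fun _ => Set.Icc 0 1) ×ˢ
          (Set.univ.pi fun _ => Set.univ.pi fun _ => Set.Icc 0 1) := by
      ext z
      simp only [Set.mem_Icc, Prod.le_def, Pi.le_def, Set.mem_prod, Set.mem_pi, Set.mem_univ,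
        true_implies, forall_and, Prod.fst_zero, Prod.snd_zero, Prod.fst_one, Prod.snd_one,
        Pi.zero_apply, Pi.one_apply]
      tauto
    rw [h1]
    exact (isCompact_univ_pi fun _ => isCompact_univ_pi fun _ => isCompact_Icc).prod
      (isCompact_univ_pi fun _ => isCompact_univ_pi fun _ => isCompact_Icc)
  -- Setting the irrelevant coordinates to zero preserves feasibility and cost, so no cost is lost
  -- by restricting to `K`.
  have himage : M.feasibleCosts lam = (fun z => M.flowCost z.1 z.2) '' K := by
    ext v
    constructor
    · rintro ⟨x, y, h, rfl⟩
      let x' : Fin N → Fin N × ℤ → ℝ := fun i q =>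
        if q ∈ M.soloStates ∧ i ∈ M.compat q then x i q else 0
      let y' : Fin N → ℤ → ℝ := fun i u =>
        if -(M.T : ℤ) ≤ u ∧ u ≤ (M.ℓ i : ℤ) - 1 then y i u else 0
      obtain ⟨h1, h2⟩ := h.congr (x' := x') (y' := y') (fun i q hq hi => if_pos ⟨hq, hi⟩)
        (fun i u hu hu' => if_pos ⟨hu, hu'⟩)
      have hx : ∀ i q, x' i q ∈ Set.Icc 0 1 := fun i q => by
        unfold x'
        split_ifs with hc
        · exact ⟨h.x_nonneg q.1 q.2 hc.1 i hc.2, h.x_le_one hc.1 hc.2⟩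
        · exact ⟨le_rfl, zero_le_one⟩
      have hy : ∀ i u, y' i u ∈ Set.Icc 0 1 := fun i u => by
        unfold y'
        split_ifs with hc
        · exact ⟨h.y_nonneg i u hc.1 hc.2, h.y_le_one i hc.1 hc.2⟩
        · exact ⟨le_rfl, zero_le_one⟩
      exact ⟨(x', y'), ⟨⟨⟨fun i q => (hx i q).1, fun i u => (hy i u).1⟩,
        ⟨fun i q => (hx i q).2, fun i u => (hy i u).2⟩⟩, h1⟩, h2⟩
    · rintro ⟨z, hz, rfl⟩
      exact ⟨z.1, z.2, hz.2, rfl⟩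
  have hcont : Continuous fun z : (Fin N → Fin N × ℤ → ℝ) × (Fin N → ℤ → ℝ) =>
      M.flowCost z.1 z.2 := by
    unfold flowCost
    fun_prop
  rw [himage]
  refine (hK.image hcont).exists_isLeast ?_
  rw [← himage]
  exact ⟨_, _, _, isFluidFeasible_unmatched lam, rfl⟩

theorem isLeast_fluidCost (lam : M.PricingPolicy) :
    IsLeast (M.feasibleCosts lam) (M.fluidCost lam) := by
  obtain ⟨v, hv⟩ := exists_isLeast_feasibleCosts lam
  rwa [fluidCost, hv.csInf_eq]

end RideModel

/-- For every initial state: the limits and the inner minima in the definitions of the two optimal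
values exist, and the fluid value is an upper bound on the optimal long-run average profit. -/
theorem proposition1 {N : ℕ} (M : RideModel N) (s₀ : SystemState N) (hs₀ : s₀ ⊆ M.soloStates) :
    (∀ (lam : M.PricingPolicy) (φ : M.MatchingPolicy),
      Tendsto (RideModel.averageProfit lam φ s₀) atTop
        (𝓝 (RideModel.longRunProfit lam φ s₀))) ∧
    (∀ lam : M.PricingPolicy, IsLeast (M.feasibleCosts lam) (M.fluidCost lam)) ∧
    M.optimalProfit s₀ ≤ M.fluidValue := by
  refine ⟨fun lam φ => ?_, RideModel.isLeast_fluidCost, ?_⟩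
  · obtain ⟨x, y, -, h⟩ := RideModel.exists_feasible_tendsto_averageProfit φ lam s₀ hs₀
    exact tendsto_nhds_limUnder ⟨_, h⟩
  -- The comparison keeps `lam` fixed: the flow induced by `φ` costs at least the minimum for the
  -- same `lam`.
  · refine iSup_le fun lam => iSup_le fun φ => le_iSup_of_le lam ?_
    obtain ⟨x, y, hxy, h⟩ := RideModel.exists_feasible_tendsto_averageProfit φ lam s₀ hs₀
    rw [RideModel.longRunProfit, h.limUnder_eq, EReal.coe_le_coe_iff]
    exact sub_le_sub_left ((RideModel.isLeast_fluidCost lam).2 ⟨x, y, hxy, rfl⟩) _
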